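/- Let $M$ be a smooth ($C^\infty$) manifold of dimension $m$ (without boundary), $\pi:TM\to M$ its tangent bundle, and let $B=\pi^\star\circ d\pi:TTM\to TTM$ be the mirror map (canonical endomorphism), where $\pi^\star$ is the vertical lift; in every chart $(x^i,v^j)$ of $TM$ induced by a chart $(x^i)$ of $M$ one has $B=\sum_j dx^j\otimes\partial_{v^j}$. For $\mu\in\Omega^1_M$, a smooth 1-form $\alpha$ on $TM$ is said to be an $\alpha_\mu$ if $\alpha\circ B=\pi^*\mu$; locally, if $\mu=a_i\,dx^i$, this means $\alpha=h_i\,dx^i+a_i\,dv^i$ with functions $h_i$ of $(x,v)$. For $\nu\in\Omega^1_M$ and $c\in C^\infty(M)$ let $f_\nu\in C^\infty(TM)$ be the fibre-affine function $f_\nu(x,v)=\nu_x(v)+c(x)$. Consider the real vector spaces of 1-forms on $TM$ $$Z=\{\alpha_\mu:\ d\alpha_\mu=0,\ \mu\in\Omega^1_M\},\qquad D=\{df_\nu:\ \nu\in\Omega^1_M,\ c\in C^\infty(M)\}.$$ Then $D\subseteq Z$ and there is a linear isomorphism $$Z/D\;\simeq\;H^1(M;\mathbb R),$$ where $H^1(M;\mathbb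 R)$ is the first de Rham cohomology of $M$ (closed smooth 1-forms modulo differentials of smooth functions). More precisely, there is a linear map $\Theta$ from $Z$ to the space of closed 1-forms on $M$ such that, for every $\alpha\in Z$ and in every chart of $M$, if $\alpha=h_i\,dx^i+a_i\,dv^i$ then $$\Theta(\alpha)=g_i\,dx^i,\qquad g_i=h_i-v^k\,\frac{\partial a_k}{\partial x^i}$$ (in particular the $g_i$ do not depend on $v$ and define a global closed 1-form on $M$), and $[\alpha]\mapsto[\Theta(\alpha)]$ is a well-defined isomorphism $Z/D\to H^1(M;\mathbb R)$. -/

import Mathlib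

open scoped Manifold ContDiff Bundle

noncomputable section

section Forms

variable {E : Type*} [NormedAddCommGroup E] [NormedSpace ℝ E]
  {H : Type*} [TopologicalSpace H] (I : ModelWithCorners ℝ E H)
  (N : Type*) [TopologicalSpace N] [ChartedSpace H N] [IsManifold I ∞ N]

/-- Smooth differential 1-forms on `N`: smooth sections of the cotangent bundle `T*N`. -/
abbrev OneForm : Type _ :=
  ContMDiffSection I (E →L[ℝ] ℝ) ∞
    (fun x : N ↦ TangentSpace I x →L[ℝ] Bundle.Trivial N ℝ x)

variable {I N}

/-- The 1-form `α` read in the preferred chart `φ` around `p`, i.e. `(φ⁻¹)^* α`. -/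
def OneForm.inChart (α : OneForm I N) (p : N) (y : E) : E →L[ℝ] ℝ :=
  (α ((extChartAt I p).symm y)).comp
    (mfderivWithin 𝓘(ℝ, E) I (extChartAt I p).symm (Set.range I) y)

/-- The exterior derivative `dα` at `p`: it is computed in the preferred chart `φ` around `p`
as `φ^* d((φ⁻¹)^* α)`, so `dα(X, Y) = D a (X) (Y) - D a (Y) (X)` where `a = (φ⁻¹)^* α`. -/
def OneForm.extDerivAt (α : OneForm I N) (p : N) : TangentSpace I p [⋀^Fin 2]→L[ℝ] ℝ :=
  (extDerivWithin
    (fun y : E ↦ ContinuousAlternatingMap.ofSubsingleton ℝ E ℝ (0 : Fin 1) (α.inChart p y))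
    (Set.range I) (extChartAt I p p)).compContinuousLinearMap
      (mvfderiv I (extChartAt I p) p)

theorem OneForm.differentiableWithinAt_inChart (α : OneForm I N) (p : N) :
    DifferentiableWithinAt ℝ (α.inChart p) (Set.range I) (extChartAt I p p) := by
  have h := α.contMDiff p
  rw [contMDiffAt_hom_bundle] at h
  have h2 := (h.2.mdifferentiableAt (by simp)).differentiableWithinAt_writtenInExtChartAt
  refine h2.congr_of_eventuallyEq_of_mem ?_ (Set.mem_range_self _)
  filter_upwards [extChartAt_target_mem_nhdsWithin (I := I) p] with y hy
  have hs : (extChartAt I p).symm y ∈ (chartAt H p).source := by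
    simpa using (extChartAt I p).map_target hy
  have hy' : extChartAt I p ((extChartAt I p).symm y) = y := (extChartAt I p).right_inv hy
  change (α ((extChartAt I p).symm y)).comp
      (mfderivWithin 𝓘(ℝ, E) I (extChartAt I p).symm (Set.range I) y) =
    ContinuousLinearMap.inCoordinates E (TangentSpace I) ℝ (Bundle.Trivial N ℝ) p
      ((extChartAt I p).symm y) p ((extChartAt I p).symm y) (α ((extChartAt I p).symm y))
  rw [ContinuousLinearMap.inCoordinates, TangentBundle.symmL_trivializationAt hs, hy']
  ext v
  simp
  rfl

theorem OneForm.differentiableWithinAt_inChart' (α : OneForm I N) (p : N) :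
    DifferentiableWithinAt ℝ
      (fun y : E ↦ ContinuousAlternatingMap.ofSubsingleton ℝ E ℝ (0 : Fin 1) (α.inChart p y))
      (Set.range I) (extChartAt I p p) :=
  (ContinuousAlternatingMap.ofSubsingletonLIE (𝕜 := ℝ) (E := E) (F := ℝ)
    (0 : Fin 1)).differentiable.differentiableAt.comp_differentiableWithinAt _
      (α.differentiableWithinAt_inChart p)

theorem OneForm.extDerivAt_add (α β : OneForm I N) (p : N) :
    (α + β).extDerivAt p = α.extDerivAt p + β.extDerivAt p := by
  have h : (fun y : E ↦ ContinuousAlternatingMap.ofSubsingleton ℝ E ℝ (0 : Fin 1)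
      ((α + β).inChart p y)) =
      (fun y : E ↦ ContinuousAlternatingMap.ofSubsingleton ℝ E ℝ (0 : Fin 1) (α.inChart p y)) +
      (fun y : E ↦ ContinuousAlternatingMap.ofSubsingleton ℝ E ℝ (0 : Fin 1) (β.inChart p y)) := by
    ext y v
    rfl
  have hu : UniqueDiffWithinAt ℝ (Set.range I) (extChartAt I p p) :=
    I.uniqueDiffOn _ (Set.mem_range_self _)
  rw [OneForm.extDerivAt, h, extDerivWithin_add hu
    (α.differentiableWithinAt_inChart' p) (β.differentiableWithinAt_inChart' p)]
  rfl

theorem OneForm.extDerivAt_smul (c : ℝ) (α : OneForm I N) (p : N) :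
    (c • α).extDerivAt p = c • α.extDerivAt p := by
  have h : (fun y : E ↦ ContinuousAlternatingMap.ofSubsingleton ℝ E ℝ (0 : Fin 1)
      ((c • α).inChart p y)) = c •
      (fun y : E ↦ ContinuousAlternatingMap.ofSubsingleton ℝ E ℝ (0 : Fin 1) (α.inChart p y)) := by
    ext y v
    rfl
  have hu : UniqueDiffWithinAt ℝ (Set.range I) (extChartAt I p p) :=
    I.uniqueDiffOn _ (Set.mem_range_self _)
  rw [OneForm.extDerivAt, h, extDerivWithin_smul c _ hu]
  rfl

variable (I N)

/-- The space of closed 1-forms on `N`. -/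
def closedOneForms : Submodule ℝ (OneForm I N) where
  carrier := {α | ∀ p, α.extDerivAt p = 0}
  add_mem' {α β} hα hβ p := by rw [OneForm.extDerivAt_add, hα p, hβ p, add_zero]
  zero_mem' p := by
    exact (congrArg (fun α : OneForm I N ↦ α.extDerivAt p)
      (zero_smul ℝ (0 : OneForm I N)).symm).trans
        ((OneForm.extDerivAt_smul (0 : ℝ) (0 : OneForm I N) p).trans (zero_smul ℝ _))
  smul_mem' c α hα p := by rw [OneForm.extDerivAt_smul, hα p, smul_zero]

/-- The differential `f ↦ df`, from smooth functions to smooth 1-forms. -/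
def differential : ContMDiffMap I 𝓘(ℝ, ℝ) N ℝ ∞ →ₗ[ℝ] OneForm I N where
  toFun f :=
    { toFun := fun x ↦ mvfderiv I f x
      contMDiff_toFun := by
        intro x
        rw [contMDiffAt_hom_bundle]
        refine ⟨contMDiffAt_id, ?_⟩
        have h := (f.contMDiff x).mfderiv_const (m := ∞) (by simp)
        refine h.congr_of_eventuallyEq (Filter.Eventually.of_forall fun y ↦ ?_)
        ext v
        simp [inTangentCoordinates, ContinuousLinearMap.inCoordinates, mvfderiv]
        rfl }
  map_add' f g := by
    ext x v
    have hf := f.contMDiff.mdifferentiableAt (x := x) (by simp)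
    have hg := g.contMDiff.mdifferentiableAt (x := x) (by simp)
    exact congrArg (fun L ↦ L v) (mvfderiv_add hf hg)
  map_smul' c f := by
    ext x v
    have hf := f.contMDiff.mdifferentiableAt (x := x) (by simp)
    have h := congrArg (fun L ↦ L v)
      (mvfderiv_smul (a := fun _ : N ↦ c) (mdifferentiableAt_const) hf)
    simp [mvfderiv_const] at h
    exact h

/-- The space of exact 1-forms on `N`. -/
def exactOneForms : Submodule ℝ (OneForm I N) := LinearMap.range (differential I N)

/-- The first de Rham cohomology `H¹(N; ℝ)`: closed 1-forms modulo exact 1-forms. -/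
abbrev DeRhamH1 : Type _ :=
  closedOneForms I N ⧸ (exactOneForms I N).submoduleOf (closedOneForms I N)

end Forms

section TangentManifold

variable {E : Type*} [NormedAddCommGroup E] [NormedSpace ℝ E]
  {H : Type*} [TopologicalSpace H] (I : ModelWithCorners ℝ E H)
  (M : Type*) [TopologicalSpace M] [ChartedSpace H M] [IsManifold I ∞ M]

variable {M} in
/-- The vertical lift at `p = (x, v)`: the derivative at `v` of the inclusion `u ↦ (x, u)` of the
fibre `T_x M` into `TM`. -/
def verticalLift (p : TangentBundle I M) : TangentSpace I p.1 →L[ℝ] TangentSpace I.tangent p :=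
  mfderiv 𝓘(ℝ, E) I.tangent (fun u : E ↦ (⟨p.1, u⟩ : TangentBundle I M)) p.2

variable {M} in
/-- The differential at `p` of the projection `π : TM → M`. -/
def dProj (p : TangentBundle I M) : TangentSpace I.tangent p →L[ℝ] TangentSpace I p.1 :=
  mfderiv I.tangent I (fun q : TangentBundle I M ↦ q.1) p

variable {M} in
/-- The mirror map (canonical endomorphism) `B` of `TTM`, namely `dx^j ⊗ ∂/∂v^j` in every chart. -/
def mirrorMap (p : TangentBundle I M) :
    TangentSpace I.tangent p →L[ℝ] TangentSpace I.tangent p :=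
  (verticalLift I p).comp (dProj I p)

variable {I M} in
/-- The 1-form `α` on `TM` is an `α_μ`, that is, `α ∘ B = π^* μ`. -/
def IsAbove (α : OneForm I.tangent (TangentBundle I M)) (μ : OneForm I M) : Prop :=
  ∀ p : TangentBundle I M, (α p).comp (mirrorMap I p) = (μ p.1).comp (dProj I p)

/-- The space of all 1-forms on `TM` which are an `α_μ` for some 1-form `μ` on `M`. -/
def aboveOneForms : Submodule ℝ (OneForm I.tangent (TangentBundle I M)) where
  carrier := {α | ∃ μ : OneForm I M, IsAbove α μ}
  add_mem' := by
    rintro α β ⟨μ, hμ⟩ ⟨ν, hν⟩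
    refine ⟨μ + ν, fun p ↦ ?_⟩
    have h := congrArg₂ (· + ·) (hμ p) (hν p)
    exact h
  zero_mem' := ⟨0, fun p ↦ by ext; rfl⟩
  smul_mem' := by
    rintro c α ⟨μ, hμ⟩
    refine ⟨c • μ, fun p ↦ ?_⟩
    have h := congrArg (c • ·) (hμ p)
    exact h

/-- The fibre-affine function `f_ν(x, v) = ν_x(v) + c(x)` on `TM`, depending linearly on the pair
formed by the 1-form `ν` and the function `c` on `M`. -/
def affineFunction :
    (OneForm I M × ContMDiffMap I 𝓘(ℝ, ℝ) M ℝ ∞) →ₗ[ℝ]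
      ContMDiffMap I.tangent 𝓘(ℝ, ℝ) (TangentBundle I M) ℝ ∞ where
  toFun νc :=
    ⟨fun p ↦ νc.1 p.1 p.2 + νc.2 p.1, by
      have hπ : ContMDiff I.tangent I ∞ (fun p : TangentBundle I M ↦ p.1) :=
        Bundle.contMDiff_proj (TangentSpace I)
      have h1 : ContMDiff I.tangent (I.prod 𝓘(ℝ, E →L[ℝ] ℝ)) ∞
          (fun p : TangentBundle I M ↦ Bundle.TotalSpace.mk' (E →L[ℝ] ℝ)
            (E := fun x : M ↦ TangentSpace I x →L[ℝ] Bundle.Trivial M ℝ x) p.1 (νc.1 p.1)) :=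
        νc.1.contMDiff.comp hπ
      have h2 : ContMDiff I.tangent (I.prod 𝓘(ℝ, E)) ∞
          (fun p : TangentBundle I M ↦ Bundle.TotalSpace.mk' E p.1 p.2) := contMDiff_id
      have h3 := h1.clm_bundle_apply h2
      have h4 : ContMDiff I.tangent 𝓘(ℝ, ℝ) ∞ (fun p : TangentBundle I M ↦
          (νc.1 p.1 p.2 : ℝ)) := by
        intro p
        exact (Bundle.contMDiffAt_totalSpace.1 (h3 p)).2
      exact h4.add (νc.2.contMDiff.comp hπ)⟩
  map_add' := by
    rintro ⟨ν, c⟩ ⟨ν', c'⟩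
    ext p
    exact add_add_add_comm _ _ _ _
  map_smul' := by
    rintro r ⟨ν, c⟩
    ext p
    exact (mul_add _ _ _).symm

/-- The closed 1-forms on `TM` of type `α_μ`. -/
def closedAbove : Submodule ℝ (OneForm I.tangent (TangentBundle I M)) :=
  closedOneForms I.tangent (TangentBundle I M) ⊓ aboveOneForms I M

/-- The differentials `df_ν` of fibre-affine functions on `TM`. -/
def affineExact : Submodule ℝ (OneForm I.tangent (TangentBundle I M)) :=
  LinearMap.range (differential I.tangent (TangentBundle I M) ∘ₗ affineFunction I M)

end TangentManifold

section Coordinates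

variable {m : ℕ} {M : Type*} [TopologicalSpace M] [ChartedSpace (EuclideanSpace ℝ (Fin m)) M]
  [IsManifold (𝓡 m) ∞ M]

/-- The coordinate vector field `∂/∂x^i` of a chart `e = (x^1, …, x^m)` of `M`, at the point with
coordinates `y`. -/
def coordVector (e : OpenPartialHomeomorph M (EuclideanSpace ℝ (Fin m)))
    (y : EuclideanSpace ℝ (Fin m)) (i : Fin m) : TangentSpace (𝓡 m) (e.symm y) :=
  mfderiv (𝓡 m) (𝓡 m) e.symm y (EuclideanSpace.single i (1 : ℝ))

/-- The inverse of the chart `(x^i, v^j)` of `TM` induced by a chart `e = (x^i)` of `M`: it sends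
coordinates `(y, w)` to the tangent vector `w^j ∂/∂x^j` at the point with coordinates `y`. -/
def tangentParam (e : OpenPartialHomeomorph M (EuclideanSpace ℝ (Fin m)))
    (z : EuclideanSpace ℝ (Fin m) × EuclideanSpace ℝ (Fin m)) : TangentBundle (𝓡 m) M :=
  ⟨e.symm z.1, mfderiv (𝓡 m) (𝓡 m) e.symm z.1 z.2⟩

/-- The coefficient `h_i` of `α = h_i dx^i + a_i dv^i` in the chart `(x^i, v^j)` of `TM` induced by
the chart `e` of `M`, as a function of the coordinates. -/
def dxCoeff (e : OpenPartialHomeomorph M (EuclideanSpace ℝ (Fin m)))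
    (α : OneForm (𝓡 m).tangent (TangentBundle (𝓡 m) M)) (i : Fin m)
    (z : EuclideanSpace ℝ (Fin m) × EuclideanSpace ℝ (Fin m)) : ℝ :=
  α (tangentParam e z) (mfderiv 𝓘(ℝ, EuclideanSpace ℝ (Fin m) × EuclideanSpace ℝ (Fin m))
    (𝓡 m).tangent (tangentParam e) z
    (EuclideanSpace.single i (1 : ℝ), (0 : EuclideanSpace ℝ (Fin m))))

/-- The coefficient `a_i` of `α = h_i dx^i + a_i dv^i` in the chart `(x^i, v^j)` of `TM` induced by
the chart `e` of `M`, as a function of the coordinates. -/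
def dvCoeff (e : OpenPartialHomeomorph M (EuclideanSpace ℝ (Fin m)))
    (α : OneForm (𝓡 m).tangent (TangentBundle (𝓡 m) M)) (i : Fin m)
    (z : EuclideanSpace ℝ (Fin m) × EuclideanSpace ℝ (Fin m)) : ℝ :=
  α (tangentParam e z) (mfderiv 𝓘(ℝ, EuclideanSpace ℝ (Fin m) × EuclideanSpace ℝ (Fin m))
    (𝓡 m).tangent (tangentParam e) z
    ((0 : EuclideanSpace ℝ (Fin m)), EuclideanSpace.single i (1 : ℝ)))

/-- In every chart of `M`, if `α = h_i dx^i + a_i dv^i` on the part of `TM` above the chart, then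
`γ = (h_i - v^k ∂a_k/∂x^i) dx^i`. -/
def IsTheta (α : OneForm (𝓡 m).tangent (TangentBundle (𝓡 m) M)) (γ : OneForm (𝓡 m) M) : Prop :=
  ∀ e ∈ IsManifold.maximalAtlas (𝓡 m) ∞ M, ∀ y ∈ e.target, ∀ (w : EuclideanSpace ℝ (Fin m))
    (i : Fin m), γ (e.symm y) (coordVector e y i) =
      dxCoeff e α i (y, w) -
        ∑ k, w k * fderiv ℝ (fun y' ↦ dvCoeff e α k (y', w)) y (EuclideanSpace.single i (1 : ℝ))

end Coordinates

end

/-!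
Let `s : M → TM` be the zero section. The map `Θ` is the pullback `α ↦ s^* α`.

In the chart `(x^i, v^j)` of `TM` induced by a chart of `M`, closedness of `α = h_i dx^i + a_i dv^i`
gives `∂h_i/∂v^k = ∂a_k/∂x^i`. If `α` is an `α_μ`, the `a_k` are the coefficients of `μ` and do not
depend on `v`, so `h_i` is affine along the fibres: `h_i(x, v) = h_i(x, 0) + v^k ∂a_k/∂x^i`
(`IsAbove.along_tangentParam_horizontal`). Since the `h_i(x, 0)` are the coefficients of `s^* α`,
this is the coordinate formula for `Θ`, and it also shows that a closed `α_0` with `s^* α = 0`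
vanishes (`IsAbove.eq_zero`).

`Θ` is surjective because `s^* π^* γ = γ` and `π^* γ` is a closed `α_0`. Next,
`s^* df_ν = d(f_ν ∘ s) = dc`, so `Θ` maps the forms `df_ν` to exact forms. Conversely, if `α` is a
closed `α_μ` with `s^* α = dc`, then for `f = μ + c` the form `α - df` is a closed `α_0` killed by
`s^*`, hence zero. So the preimage of the exact forms under `Θ` is exactly the space of the `df_ν`,
and `Θ` descends to an isomorphism of the quotients.

All of this rests on the compatibility of the exterior derivative, which is defined through the
preferred charts, with pullback along arbitrary smooth parametrizations (`OneForm.extDeriv_along`).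
-/

open Filter Topology

/-! ### Pullback of 1-forms and the exterior derivative -/

section Pullback

variable {V : Type*} [NormedAddCommGroup V] [NormedSpace ℝ V]
  {E : Type*} [NormedAddCommGroup E] [NormedSpace ℝ E]
  {H : Type*} [TopologicalSpace H] {I : ModelWithCorners ℝ E H}
  {N : Type*} [TopologicalSpace N] [ChartedSpace H N] [IsManifold I ∞ N]
  {E' : Type*} [NormedAddCommGroup E'] [NormedSpace ℝ E']
  {H' : Type*} [TopologicalSpace H'] {I' : ModelWithCorners ℝ E' H'}
  {N' : Type*} [TopologicalSpace N'] [ChartedSpace H' N'] [IsManifold I' ∞ N']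

/-- The pullback `φ^* α` of a 1-form along a map `φ` from a normed space (typically the inverse of
a chart, so that only its values on an open set matter), as a function with values in the dual. -/
noncomputable def OneForm.along (α : OneForm I N) (φ : V → N) (u : V) : V →L[ℝ] ℝ :=
  (α (φ u)).comp (mfderiv 𝓘(ℝ, V) I φ u)

theorem OneForm.inChart_eq_along [I.Boundaryless] (α : OneForm I N) (p : N) :
    α.inChart p = α.along (extChartAt I p).symm := by
  ext1 y
  simp only [inChart, along, I.range_eq_univ, mfderivWithin_univ]

/-- Near `u`, the form `φ^* α` is the pullback of the form `α` read in the preferred chart at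
`φ u` along the map `φ` read in that chart. -/
theorem OneForm.along_eventuallyEq [I.Boundaryless] (α : OneForm I N) {φ : V → N} {u : V}
    (hφ : ContMDiffAt 𝓘(ℝ, V) I ∞ φ u) :
    α.along φ =ᶠ[𝓝 u] fun u' ↦ (α.inChart (φ u) (extChartAt I (φ u) (φ u'))).comp
      (fderiv ℝ (extChartAt I (φ u) ∘ φ) u') := by
  have hsrc : ∀ᶠ u' in 𝓝 u, φ u' ∈ (extChartAt I (φ u)).source :=
    hφ.continuousAt (extChartAt_source_mem_nhds (I := I) (φ u))
  have hdiff : ∀ᶠ u' in 𝓝 u, ContMDiffAt 𝓘(ℝ, V) I 1 φ u' :=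
    (contMDiffAt_iff_contMDiffAt_nhds (n := 1) (by simp)).1
      (hφ.of_le (by norm_cast))
  filter_upwards [hsrc, hsrc.eventually_nhds, hdiff] with u' hu' hev hd
  have hd' : MDifferentiableAt 𝓘(ℝ, V) I φ u' := hd.mdifferentiableAt (by simp)
  have hu'c : φ u' ∈ (chartAt H (φ u)).source := by simpa using hu'
  have h := mfderiv_comp u' (mdifferentiableAt_extChartAt (I := I) hu'c) hd'
  rw [← mfderiv_eq_fderiv, h]
  simp only [inChart, along, I.range_eq_univ, mfderivWithin_univ]
  have hid := mfderivWithin_extChartAt_symm_comp_mfderiv_extChartAt' (I := I) hu'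
  rw [I.range_eq_univ, mfderivWithin_univ] at hid
  ext X
  have := congrArg (fun L ↦ α (φ u') (L (mfderiv 𝓘(ℝ, V) I φ u' X))) hid
  simp only [ContinuousLinearMap.comp_apply] at this ⊢
  rw [(extChartAt I (φ u)).left_inv hu']
  exact this.symm

/-- The exterior derivative can be computed in any smooth parametrization `φ`, not only in the
preferred chart: `d(φ^* α) = φ^* dα`. -/
theorem OneForm.extDeriv_along [I.Boundaryless] (α : OneForm I N) {φ : V → N} {u : V}
    (hφ : ContMDiffAt 𝓘(ℝ, V) I ∞ φ u) :
    extDeriv (fun u' ↦ ContinuousAlternatingMap.ofSubsingleton ℝ V ℝ (0 : Fin 1) (α.along φ u')) u =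
      (α.extDerivAt (φ u)).compContinuousLinearMap (mfderiv 𝓘(ℝ, V) I φ u) := by
  have h := (α.along_eventuallyEq hφ).fun_comp
    (ContinuousAlternatingMap.ofSubsingleton ℝ V ℝ (0 : Fin 1))
  have hψ : ContDiffAt ℝ ∞ (extChartAt I (φ u) ∘ φ) u :=
    ((contMDiffAt_extChartAt (I := I) (x := φ u)).comp u hφ).contDiffAt
  have hω := α.differentiableWithinAt_inChart' (φ u)
  rw [I.range_eq_univ, differentiableWithinAt_univ] at hω
  have h2 := extDeriv_pullback (f := extChartAt I (φ u) ∘ φ) hω hψ (by simp; norm_cast)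
  refine (h.extDeriv_eq.trans h2).trans ?_
  have h3 := mfderiv_comp u (mdifferentiableAt_extChartAt (I := I) (mem_chart_source H (φ u)))
    (hφ.mdifferentiableAt (by simp))
  rw [OneForm.extDerivAt, I.range_eq_univ, extDerivWithin_univ, ← mfderiv_eq_fderiv, h3]
  rfl

theorem OneForm.extDerivAt_eq_zero_of_inChart [I.Boundaryless] {α : OneForm I N} {p : N}
    (h : extDeriv (fun y ↦ ContinuousAlternatingMap.ofSubsingleton ℝ E ℝ (0 : Fin 1)
      (α.inChart p y)) (extChartAt I p p) = 0) : α.extDerivAt p = 0 := by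
  rw [OneForm.extDerivAt, I.range_eq_univ, extDerivWithin_univ, h]
  rfl

theorem OneForm.differentiableAt_along [I.Boundaryless] (α : OneForm I N) {φ : V → N} {u : V}
    (hφ : ContMDiffAt 𝓘(ℝ, V) I ∞ φ u) : DifferentiableAt ℝ (α.along φ) u := by
  refine DifferentiableAt.congr_of_eventuallyEq ?_ (α.along_eventuallyEq hφ)
  have hψ : ContDiffAt ℝ ∞ (extChartAt I (φ u) ∘ φ) u :=
    ((contMDiffAt_extChartAt (I := I) (x := φ u)).comp u hφ).contDiffAt
  have hω := α.differentiableWithinAt_inChart (φ u)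
  rw [I.range_eq_univ, differentiableWithinAt_univ] at hω
  refine DifferentiableAt.clm_comp
    (DifferentiableAt.comp (g := α.inChart (φ u)) (f := extChartAt I (φ u) ∘ φ) u hω
      (hψ.differentiableAt (by simp))) ?_
  exact (hψ.fderiv_right (m := 1) (by norm_cast)).differentiableAt (by simp)

theorem OneForm.extDeriv_along_eq_zero [I.Boundaryless] {α : OneForm I N}
    (hα : α ∈ closedOneForms I N) {φ : V → N} {u : V} (hφ : ContMDiffAt 𝓘(ℝ, V) I ∞ φ u) :
    extDeriv (fun u' ↦ ContinuousAlternatingMap.ofSubsingleton ℝ V ℝ (0 : Fin 1) (α.along φ u')) u =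
      0 := by
  rw [α.extDeriv_along hφ, hα (φ u)]
  rfl

/-- Closedness in coordinates: the coefficients of a closed form in any smooth parametrization have
symmetric partial derivatives. -/
theorem OneForm.fderiv_along_symm [I.Boundaryless] {α : OneForm I N} (hα : α ∈ closedOneForms I N)
    {φ : V → N} {u : V} (hφ : ContMDiffAt 𝓘(ℝ, V) I ∞ φ u) (X Y : V) :
    fderiv ℝ (fun u' ↦ α.along φ u' Y) u X = fderiv ℝ (fun u' ↦ α.along φ u' X) u Y := by
  have h := DFunLike.congr_fun (extDeriv_along_eq_zero hα hφ) ![X, Y]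
  have hd : DifferentiableAt ℝ
      (fun u' ↦ ContinuousAlternatingMap.ofSubsingleton ℝ V ℝ (0 : Fin 1) (α.along φ u')) u :=
    (ContinuousAlternatingMap.ofSubsingletonLIE (𝕜 := ℝ) (E := V) (F := ℝ)
      (0 : Fin 1)).differentiable.differentiableAt.comp u (α.differentiableAt_along hφ)
  rw [extDeriv_apply hd] at h
  simp [Fin.removeNth] at h
  linarith

/-- The pullback `f^* α` of a 1-form along a smooth map of manifolds. -/
noncomputable def OneForm.pullback (f : ContMDiffMap I' I N' N ∞) :
    OneForm I N →ₗ[ℝ] OneForm I' N' where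
  toFun α :=
    { toFun := fun x ↦ (α (f x)).comp (mfderiv I' I f x)
      contMDiff_toFun := by
        intro x
        rw [contMDiffAt_hom_bundle]
        refine ⟨contMDiffAt_id, ?_⟩
        have hα := α.contMDiff (f x)
        rw [contMDiffAt_hom_bundle] at hα
        have h1 := hα.2.comp x (f.contMDiff x)
        have h2 := (f.contMDiff x).mfderiv_const (m := ∞) (by simp)
        refine (h1.clm_comp h2).congr_of_eventuallyEq ?_
        have hs : ∀ᶠ y in 𝓝 x, f y ∈ (chartAt H (f x)).source :=
          (f.contMDiff.continuous.continuousAt (x := x)) (chart_source_mem_nhds H (f x))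
        filter_upwards [hs] with y hy
        ext v
        simp [inTangentCoordinates, ContinuousLinearMap.inCoordinates]
        congr 1
        refine (Bundle.Trivialization.symmL_continuousLinearMapAt (R := ℝ)
          (trivializationAt E (TangentSpace I) (f x)) ?_ _).symm
        simpa using hy }
  map_add' α β := by ext x v; rfl
  map_smul' c α := by ext x v; rfl

theorem OneForm.pullback_along (f : ContMDiffMap I' I N' N ∞) (α : OneForm I N) {φ : V → N'} {u : V}
    (hφ : MDifferentiableAt 𝓘(ℝ, V) I' φ u) :
    (OneForm.pullback f α).along φ u = α.along (f ∘ φ) u := by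
  have h := mfderiv_comp u (f.contMDiff.mdifferentiableAt (x := φ u) (by simp)) hφ
  ext X
  rw [OneForm.along, OneForm.along, h]
  rfl

theorem OneForm.pullback_mem_closedOneForms [I.Boundaryless] [I'.Boundaryless]
    (f : ContMDiffMap I' I N' N ∞) {α : OneForm I N} (hα : α ∈ closedOneForms I N) :
    OneForm.pullback f α ∈ closedOneForms I' N' := by
  intro p
  apply extDerivAt_eq_zero_of_inChart
  have hs : ContMDiffAt 𝓘(ℝ, E') I' ∞ (extChartAt I' p).symm (extChartAt I' p p) :=
    (contMDiffOn_extChartAt_symm p).contMDiffAt (extChartAt_target_mem_nhds p)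
  have hev : ∀ᶠ y in 𝓝 (extChartAt I' p p),
      MDifferentiableAt 𝓘(ℝ, E') I' (extChartAt I' p).symm y := by
    filter_upwards [extChartAt_target_mem_nhds (I := I') p] with y hy
    exact ((contMDiffOn_extChartAt_symm (n := ∞) p).contMDiffAt
      ((isOpen_extChartAt_target (I := I') p).mem_nhds hy)).mdifferentiableAt (by simp)
  have h : (fun y ↦ ContinuousAlternatingMap.ofSubsingleton ℝ E' ℝ (0 : Fin 1)
      ((pullback f α).inChart p y)) =ᶠ[𝓝 (extChartAt I' p p)]
      fun y ↦ ContinuousAlternatingMap.ofSubsingleton ℝ E' ℝ (0 : Fin 1)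
        (α.along (f ∘ (extChartAt I' p).symm) y) := by
    filter_upwards [hev] with y hy
    rw [inChart_eq_along, pullback_along f α hy]
  rw [h.extDeriv_eq, extDeriv_along_eq_zero hα (f.contMDiff.contMDiffAt.comp _ hs)]

theorem differential_mem_closedOneForms [I.Boundaryless] (f : ContMDiffMap I 𝓘(ℝ, ℝ) N ℝ ∞) :
    differential I N f ∈ closedOneForms I N := by
  intro p
  apply OneForm.extDerivAt_eq_zero_of_inChart
  have hs : ContMDiffAt 𝓘(ℝ, E) I ∞ (extChartAt I p).symm (extChartAt I p p) :=
    (contMDiffOn_extChartAt_symm p).contMDiffAt (extChartAt_target_mem_nhds p)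
  have hf : ContDiffAt ℝ ∞ (f ∘ (extChartAt I p).symm) (extChartAt I p p) :=
    (f.contMDiff.contMDiffAt.comp _ hs).contDiffAt
  have h : (fun y ↦ ContinuousAlternatingMap.ofSubsingleton ℝ E ℝ (0 : Fin 1)
      ((differential I N f).inChart p y)) =ᶠ[𝓝 (extChartAt I p p)]
      extDeriv fun y ↦ ContinuousAlternatingMap.constOfIsEmpty ℝ E (Fin 0)
        ((f ∘ (extChartAt I p).symm) y) := by
    filter_upwards [extChartAt_target_mem_nhds (I := I) p] with y hy
    have hy' := ((contMDiffOn_extChartAt_symm (n := ∞) p).contMDiffAt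
      ((isOpen_extChartAt_target (I := I) p).mem_nhds hy)).mdifferentiableAt (by simp)
    have h3 := mfderiv_comp y (f.contMDiff.mdifferentiableAt (by simp)) hy'
    rw [extDeriv_constOfIsEmpty, ← mfderiv_eq_fderiv, h3, OneForm.inChart_eq_along]
    rfl
  -- In the chart the form is `d` of a 0-form, so `d ∘ d = 0` applies.
  rw [h.extDeriv_eq]
  refine extDeriv_extDeriv_apply (r := ∞) ?_ (by simp; norm_cast)
  exact (ContinuousAlternatingMap.constOfIsEmptyLIE ℝ E ℝ (Fin 0)).contDiff.contDiffAt.comp _ hf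

theorem pullback_differential (f : ContMDiffMap I' I N' N ∞) (g : ContMDiffMap I 𝓘(ℝ, ℝ) N ℝ ∞) :
    OneForm.pullback f (differential I N g) = differential I' N' (g.comp f) := by
  ext x v
  exact (mvfderiv_comp_apply x (g.contMDiff.mdifferentiableAt (by simp))
    (f.contMDiff.mdifferentiableAt (by simp)) v).symm

end Pullback

/-! ### The zero section, the projection and the mirror map -/

section TangentBundleForms

variable {E : Type*} [NormedAddCommGroup E] [NormedSpace ℝ E]
  {H : Type*} [TopologicalSpace H] (I : ModelWithCorners ℝ E H)
  (M : Type*) [TopologicalSpace M] [ChartedSpace H M] [IsManifold I ∞ M]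

/-- The projection `π : TM → M` as a smooth map. -/
noncomputable def smoothProj : ContMDiffMap I.tangent I (TangentBundle I M) M ∞ :=
  ⟨fun p ↦ p.1, Bundle.contMDiff_proj (TangentSpace I)⟩

/-- The zero section `M → TM` as a smooth map. -/
noncomputable def smoothZeroSection : ContMDiffMap I I.tangent M (TangentBundle I M) ∞ :=
  ⟨fun x ↦ ⟨x, 0⟩, Bundle.contMDiff_zeroSection ℝ (TangentSpace I)⟩

variable {M}

/-- The inclusion of the fibre `T_x M` into `TM` is smooth. -/
theorem contMDiff_tangentBundle_mk (x : M) :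
    ContMDiff 𝓘(ℝ, E) I.tangent ∞ (fun u : E ↦ (⟨x, u⟩ : TangentBundle I M)) := by
  intro u
  rw [Bundle.contMDiffAt_totalSpace]
  refine ⟨contMDiffAt_const, ?_⟩
  let L : E →L[ℝ] E := (trivializationAt E (TangentSpace I) x).continuousLinearMapAt ℝ x
  refine L.contMDiff.contMDiffAt.congr_of_eventuallyEq (Eventually.of_forall fun u' ↦ ?_)
  have hx : x ∈ (trivializationAt E (TangentSpace I) x).baseSet :=
    FiberBundle.mem_baseSet_trivializationAt' x
  exact (congrFun (Bundle.Trivialization.coe_linearMapAt_of_mem (R := ℝ) _ hx) u').symm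

theorem dProj_comp_verticalLift (p : TangentBundle I M) :
    (dProj I p).comp (verticalLift I p) = 0 := by
  have h := mfderiv_comp (I := 𝓘(ℝ, E)) (I' := I.tangent) (I'' := I)
    (f := fun u : E ↦ (⟨p.1, u⟩ : TangentBundle I M)) p.2
    ((smoothProj I M).contMDiff.mdifferentiableAt (x := p) (by simp))
    ((contMDiff_tangentBundle_mk I p.1).mdifferentiableAt (by simp))
  exact h.symm.trans mfderiv_const

variable {I}

theorem isAbove_pullback_smoothProj (γ : OneForm I M) :
    IsAbove (OneForm.pullback (smoothProj I M) γ) 0 := by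
  intro p
  ext X
  have h := congrArg (fun L ↦ γ p.1 (L (dProj I p X))) (dProj_comp_verticalLift I p)
  exact h.trans (map_zero _)

/-- On the fibre over `x` the function `f_ν` is `ν_x` plus a constant, so that `df_ν` restricted
to vertical vectors is `ν`. -/
theorem isAbove_differential_affineFunction
    (νc : OneForm I M × ContMDiffMap I 𝓘(ℝ, ℝ) M ℝ ∞) :
    IsAbove (differential I.tangent (TangentBundle I M) (affineFunction I M νc)) νc.1 := by
  intro p
  ext X
  have h := mvfderiv_comp_apply (I := I.tangent) (I' := 𝓘(ℝ, E))
    (f := fun u : E ↦ (⟨p.1, u⟩ : TangentBundle I M)) p.2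
    ((affineFunction I M νc).contMDiff.mdifferentiableAt (x := p) (by simp))
    ((contMDiff_tangentBundle_mk I p.1).mdifferentiableAt (by simp)) (dProj I p X)
  refine h.symm.trans ?_
  let L : E →L[ℝ] ℝ := νc.1 p.1
  have h2 : HasFDerivAt (fun u : E ↦ L u + νc.2 p.1) L p.2 := L.hasFDerivAt.add_const _
  exact congrArg (fun L : E →L[ℝ] ℝ ↦ L (dProj I p X)) h2.hasMFDerivAt.mfderiv

theorem pullback_smoothZeroSection_pullback_smoothProj (γ : OneForm I M) :
    OneForm.pullback (smoothZeroSection I M) (OneForm.pullback (smoothProj I M) γ) = γ := by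
  ext x X
  have h := mfderiv_comp (I := I) (I' := I.tangent) (I'' := I) x
    ((smoothProj I M).contMDiff.mdifferentiableAt (x := smoothZeroSection I M x) (by simp))
    ((smoothZeroSection I M).contMDiff.mdifferentiableAt (x := x) (by simp))
  have h' := h.symm.trans (mfderiv_id (I := I) (x := x))
  exact congrArg (fun L : TangentSpace I x →L[ℝ] TangentSpace I x ↦ γ x (L X)) h'

theorem pullback_smoothZeroSection_differential_affineFunction
    (νc : OneForm I M × ContMDiffMap I 𝓘(ℝ, ℝ) M ℝ ∞) :
    OneForm.pullback (smoothZeroSection I M)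
      (differential I.tangent (TangentBundle I M) (affineFunction I M νc)) =
      differential I M νc.2 := by
  rw [pullback_differential]
  congr 1
  ext x
  have h : νc.1 x (0 : TangentSpace I x) + νc.2 x = νc.2 x := by
    rw [map_zero]
    exact zero_add _
  exact h

theorem affineExact_le_closedAbove [I.Boundaryless] : affineExact I M ≤ closedAbove I M := by
  rintro _ ⟨νc, rfl⟩
  exact ⟨differential_mem_closedOneForms _, νc.1, isAbove_differential_affineFunction νc⟩

theorem IsAbove.sub {α β : OneForm I.tangent (TangentBundle I M)} {μ ν : OneForm I M}
    (hα : IsAbove α μ) (hβ : IsAbove β ν) : IsAbove (α - β) (μ - ν) := by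
  intro p
  have h := congrArg₂ (· - ·) (hα p) (hβ p)
  exact h

end TangentBundleForms

/-! ### Coordinates on the tangent bundle -/

section Coordinates

variable {m : ℕ} {M : Type*} [TopologicalSpace M] [ChartedSpace (EuclideanSpace ℝ (Fin m)) M]
  [IsManifold (𝓡 m) ∞ M] {e : OpenPartialHomeomorph M (EuclideanSpace ℝ (Fin m))}

local notation "𝔼" m => EuclideanSpace ℝ (Fin m)

/-- `tangentParam e` is smooth, being the tangent map of `e.symm` read on `T𝔼 = 𝔼 × 𝔼`. -/
theorem contMDiffAt_tangentParam (he : e ∈ IsManifold.maximalAtlas (𝓡 m) ∞ M)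
    {z : (𝔼 m) × (𝔼 m)} (hz : z.1 ∈ e.target) :
    ContMDiffAt 𝓘(ℝ, (𝔼 m) × (𝔼 m)) (𝓡 m).tangent ∞ (tangentParam e) z := by
  have h1 : ContMDiffAt 𝓘(ℝ, (𝔼 m) × (𝔼 m)) (𝓡 m).tangent ∞
      (fun z : (𝔼 m) × (𝔼 m) ↦ (⟨z.1, z.2⟩ : TangentBundle (𝓡 m) (𝔼 m))) z := by
    rw [Bundle.contMDiffAt_totalSpace]
    refine ⟨contDiff_fst.contMDiff.contMDiffAt, ?_⟩
    refine contDiff_snd.contMDiff.contMDiffAt.congr_of_eventuallyEq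
      (Eventually.of_forall fun u' ↦ ?_)
    simp
  have h2 := (contMDiffOn_symm_of_mem_maximalAtlas he).contMDiffOn_tangentMapWithin (m := ∞)
    (by simp) e.open_target.uniqueMDiffOn
  have hev : ∀ᶠ z' in 𝓝 z, z'.1 ∈ e.target :=
    continuousAt_fst (e.open_target.mem_nhds hz)
  have hopen : IsOpen (Bundle.TotalSpace.proj ⁻¹' e.target : Set (TangentBundle (𝓡 m) (𝔼 m))) :=
    e.open_target.preimage (FiberBundle.continuous_proj _ _)
  refine ((h2.contMDiffAt (hopen.mem_nhds hz)).comp z h1).congr_of_eventuallyEq ?_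
  filter_upwards [hev] with z' hz'
  simp only [tangentParam, Function.comp_apply, tangentMapWithin,
    mfderivWithin_of_isOpen e.open_target hz']

theorem dProj_mfderiv_tangentParam (he : e ∈ IsManifold.maximalAtlas (𝓡 m) ∞ M)
    {z : (𝔼 m) × (𝔼 m)} (hz : z.1 ∈ e.target) (X W : 𝔼 m) :
    dProj (𝓡 m) (tangentParam e z) (mfderiv 𝓘(ℝ, (𝔼 m) × (𝔼 m)) (𝓡 m).tangent (tangentParam e) z
      (X, W)) = mfderiv (𝓡 m) (𝓡 m) e.symm z.1 X := by
  have h := mfderiv_comp (I := 𝓘(ℝ, (𝔼 m) × (𝔼 m))) (I' := (𝓡 m).tangent) (I'' := 𝓡 m) z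
    ((smoothProj (𝓡 m) M).contMDiff.mdifferentiableAt (x := tangentParam e z) (by simp))
    ((contMDiffAt_tangentParam he hz).mdifferentiableAt (by simp))
  have h2 := mfderiv_comp (I := 𝓘(ℝ, (𝔼 m) × (𝔼 m))) (I' := 𝓡 m) (I'' := 𝓡 m) z
    (f := Prod.fst)
    ((contMDiffAt_symm_of_mem_maximalAtlas he hz).mdifferentiableAt (by simp))
    (contDiff_fst (n := 1).contMDiff.mdifferentiableAt (by simp))
  have h3 : mfderiv 𝓘(ℝ, (𝔼 m) × (𝔼 m)) (𝓡 m) (Prod.fst : (𝔼 m) × (𝔼 m) → 𝔼 m) z =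
      ContinuousLinearMap.fst ℝ (𝔼 m) (𝔼 m) := hasFDerivAt_fst.hasMFDerivAt.mfderiv
  have h4 := h.symm.trans h2
  rw [h3] at h4
  exact congrArg (fun L : (𝔼 m) × (𝔼 m) →L[ℝ] 𝔼 m ↦ L (X, W)) h4

/-- The coordinate vector fields `∂/∂v^j` are the vertical lifts of the `∂/∂x^j`. -/
theorem mfderiv_tangentParam_vertical (he : e ∈ IsManifold.maximalAtlas (𝓡 m) ∞ M)
    {z : (𝔼 m) × (𝔼 m)} (hz : z.1 ∈ e.target) (W : 𝔼 m) :
    mfderiv 𝓘(ℝ, (𝔼 m) × (𝔼 m)) (𝓡 m).tangent (tangentParam e) z ((0 : 𝔼 m), W) =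
      verticalLift (𝓡 m) (tangentParam e z) (mfderiv (𝓡 m) (𝓡 m) e.symm z.1 W) := by
  let L : (𝔼 m) →L[ℝ] 𝔼 m := mfderiv (𝓡 m) (𝓡 m) e.symm z.1
  have hι : HasFDerivAt (fun w : 𝔼 m ↦ (z.1, w)) (ContinuousLinearMap.inr ℝ (𝔼 m) (𝔼 m)) z.2 :=
    hasFDerivAt_prodMk_right z.1 z.2
  have h1 := ((contMDiffAt_tangentParam he hz).mdifferentiableAt (by simp)).hasMFDerivAt.comp z.2
    (f := fun w : 𝔼 m ↦ (z.1, w)) hι.hasMFDerivAt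
  have h2 := ((contMDiff_tangentBundle_mk (𝓡 m) (e.symm z.1)).mdifferentiableAt (x := L z.2)
    (by simp)).hasMFDerivAt.comp z.2 (f := L) L.hasFDerivAt.hasMFDerivAt
  exact congrArg (fun L : (𝔼 m) →L[ℝ] (𝔼 m) × (𝔼 m) ↦ L W) (hasMFDerivAt_unique h1 h2)

theorem mirrorMap_mfderiv_tangentParam (he : e ∈ IsManifold.maximalAtlas (𝓡 m) ∞ M)
    {z : (𝔼 m) × (𝔼 m)} (hz : z.1 ∈ e.target) (X W : 𝔼 m) :
    mirrorMap (𝓡 m) (tangentParam e z) (mfderiv 𝓘(ℝ, (𝔼 m) × (𝔼 m)) (𝓡 m).tangent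
      (tangentParam e) z (X, W)) =
      mfderiv 𝓘(ℝ, (𝔼 m) × (𝔼 m)) (𝓡 m).tangent (tangentParam e) z ((0 : 𝔼 m), X) := by
  rw [mfderiv_tangentParam_vertical he hz, ← dProj_mfderiv_tangentParam he hz X W]
  rfl

/-- If `α` is an `α_μ`, its coefficients `a_i` are those of `μ`; in particular they do not depend
on `v`. -/
theorem IsAbove.along_tangentParam_vertical {α : OneForm (𝓡 m).tangent (TangentBundle (𝓡 m) M)}
    {μ : OneForm (𝓡 m) M} (hμ : IsAbove α μ) (he : e ∈ IsManifold.maximalAtlas (𝓡 m) ∞ M)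
    {z : (𝔼 m) × (𝔼 m)} (hz : z.1 ∈ e.target) (W : 𝔼 m) :
    α.along (tangentParam e) z (0, W) = μ.along e.symm z.1 W := by
  have h := congrArg (fun L ↦ L (mfderiv 𝓘(ℝ, (𝔼 m) × (𝔼 m)) (𝓡 m).tangent
      (tangentParam e) z (W, (0 : 𝔼 m)))) (hμ (tangentParam e z))
  have h1 := congrArg (α (tangentParam e z)) (mirrorMap_mfderiv_tangentParam he hz W 0)
  have h2 := congrArg (μ (tangentParam e z).1) (dProj_mfderiv_tangentParam he hz W 0)
  exact h1.symm.trans (h.trans h2)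

/-- The closedness relation `∂h_i/∂v^k = ∂a_k/∂x^i`, whose right-hand side does not depend on `v`,
integrated along the fibre: `h_i(x, v) = h_i(x, 0) + v^k ∂a_k/∂x^i`. -/
theorem IsAbove.along_tangentParam_horizontal
    {α : OneForm (𝓡 m).tangent (TangentBundle (𝓡 m) M)} {μ : OneForm (𝓡 m) M} (hμ : IsAbove α μ)
    (hα : α ∈ closedOneForms (𝓡 m).tangent (TangentBundle (𝓡 m) M))
    (he : e ∈ IsManifold.maximalAtlas (𝓡 m) ∞ M) {y : 𝔼 m} (hy : y ∈ e.target) (w X : 𝔼 m) :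
    α.along (tangentParam e) (y, w) (X, 0) =
      α.along (tangentParam e) (y, 0) (X, 0) + fderiv ℝ (μ.along e.symm) y X w := by
  have hparam (w' : 𝔼 m) := contMDiffAt_tangentParam (z := (y, w')) he hy
  have hμd : DifferentiableAt ℝ (μ.along e.symm) y :=
    μ.differentiableAt_along (contMDiffAt_symm_of_mem_maximalAtlas he hy)
  have hαd (w' : 𝔼 m) (Z : (𝔼 m) × (𝔼 m)) :
      DifferentiableAt ℝ (fun z ↦ α.along (tangentParam e) z Z) (y, w') :=
    (α.differentiableAt_along (hparam w')).clm_apply (differentiableAt_const Z)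
  have hfib (w' : 𝔼 m) : HasFDerivAt (fun w ↦ α.along (tangentParam e) (y, w) (X, 0))
      (fderiv ℝ (μ.along e.symm) y X) w' := by
    have h1 := (hαd w' (X, 0)).hasFDerivAt.comp w' (hasFDerivAt_prodMk_right y w')
    refine h1.congr_fderiv ?_
    ext W
    -- Closedness trades the derivative of `h` along the fibre for that of `a` along the base.
    have h2 := OneForm.fderiv_along_symm hα (hparam w') (0, W) (X, 0)
    have h3 := (hαd w' (0, W)).hasFDerivAt.comp (f := fun y' ↦ (y', w')) y
      (hasFDerivAt_prodMk_left y w')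
    have h4 : HasFDerivAt (fun y' ↦ α.along (tangentParam e) (y', w') (0, W))
        ((fderiv ℝ (μ.along e.symm) y).flip W) y := by
      refine (HasFDerivAt.congr_of_eventuallyEq
        (hμd.hasFDerivAt.clm_apply (hasFDerivAt_const W y)) ?_).congr_fderiv ?_
      · filter_upwards [e.open_target.mem_nhds hy] with y' hy'
        exact hμ.along_tangentParam_vertical he (z := (y', w')) hy' W
      · ext; simp
    have h5 := congrArg (fun L : (𝔼 m) →L[ℝ] ℝ ↦ L X) (h3.unique h4)
    exact h2.trans h5
  -- `w ↦ h(y, w) - ∂a(y) w` has zero derivative, so its values at `w` and at `0` agree.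
  have hconst := is_const_of_fderiv_eq_zero (𝕜 := ℝ)
    (f := fun w ↦ α.along (tangentParam e) (y, w) (X, 0) - fderiv ℝ (μ.along e.symm) y X w)
    (fun w' ↦ ((hfib w').sub (ContinuousLinearMap.hasFDerivAt _)).differentiableAt)
    (fun w' ↦ ((hfib w').sub (ContinuousLinearMap.hasFDerivAt _)).fderiv.trans (sub_self _)) w 0
  simp only [map_zero, sub_zero] at hconst
  linarith

/-- In coordinates `s^* α = h_i(x, 0) dx^i`, where `s` is the zero section. -/
theorem OneForm.pullback_smoothZeroSection_along
    (α : OneForm (𝓡 m).tangent (TangentBundle (𝓡 m) M))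
    (he : e ∈ IsManifold.maximalAtlas (𝓡 m) ∞ M) {y : 𝔼 m} (hy : y ∈ e.target) (X : 𝔼 m) :
    (OneForm.pullback (smoothZeroSection (𝓡 m) M) α).along e.symm y X =
      α.along (tangentParam e) (y, 0) (X, 0) := by
  have hcomp : smoothZeroSection (𝓡 m) M ∘ e.symm = tangentParam e ∘ fun y' ↦ (y', 0) := by
    funext y'
    exact congrArg (Bundle.TotalSpace.mk (e.symm y'))
      (map_zero (mfderiv (𝓡 m) (𝓡 m) e.symm y')).symm
  have hι : HasFDerivAt (fun y' : 𝔼 m ↦ (y', (0 : 𝔼 m)))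
    (ContinuousLinearMap.inl ℝ (𝔼 m) (𝔼 m)) y := hasFDerivAt_prodMk_left y 0
  have h1 := ((contMDiffAt_tangentParam (z := (y, 0)) he hy).mdifferentiableAt
    (by simp)).hasMFDerivAt.comp y (f := fun y' : 𝔼 m ↦ (y', (0 : 𝔼 m))) hι.hasMFDerivAt
  rw [OneForm.pullback_along _ _
    ((contMDiffAt_symm_of_mem_maximalAtlas he hy).mdifferentiableAt (by simp)), hcomp,
    OneForm.along]
  exact congrArg (fun L : (𝔼 m) →L[ℝ] _ ↦ α (tangentParam e (y, 0)) (L X)) h1.mfderiv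

/-- The pullback by the zero section is given by `g_i = h_i - v^k ∂a_k/∂x^i` in every chart. -/
theorem IsAbove.isTheta_pullback_smoothZeroSection
    {α : OneForm (𝓡 m).tangent (TangentBundle (𝓡 m) M)} {μ : OneForm (𝓡 m) M} (hμ : IsAbove α μ)
    (hα : α ∈ closedOneForms (𝓡 m).tangent (TangentBundle (𝓡 m) M)) :
    IsTheta α (OneForm.pullback (smoothZeroSection (𝓡 m) M) α) := by
  intro e he y hy w i
  have hμd : DifferentiableAt ℝ (μ.along e.symm) y :=
    μ.differentiableAt_along (contMDiffAt_symm_of_mem_maximalAtlas he hy)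
  have hk (k : Fin m) : fderiv ℝ (fun y' ↦ dvCoeff e α k (y', w)) y
      (EuclideanSpace.single i (1 : ℝ)) =
      fderiv ℝ (μ.along e.symm) y (EuclideanSpace.single i 1) (EuclideanSpace.single k 1) := by
    have h : HasFDerivAt (fun y' ↦ dvCoeff e α k (y', w)) _ y :=
      (hμd.hasFDerivAt.clm_apply (hasFDerivAt_const (EuclideanSpace.single k (1 : ℝ)) y)
        ).congr_of_eventuallyEq <| by
        filter_upwards [e.open_target.mem_nhds hy] with y' hy'
        exact hμ.along_tangentParam_vertical he (z := (y', w)) hy' _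
    rw [h.fderiv]
    simp
  have hw : w = ∑ k, w k • EuclideanSpace.single k (1 : ℝ) := by
    ext j
    simp [Finset.sum_apply, Pi.single_apply]
  have h1 := α.pullback_smoothZeroSection_along he hy (EuclideanSpace.single i 1)
  have h2 := hμ.along_tangentParam_horizontal hα he hy w (EuclideanSpace.single i 1)
  have h3 : fderiv ℝ (μ.along e.symm) y (EuclideanSpace.single i 1) w =
      ∑ k, w k * fderiv ℝ (μ.along e.symm) y (EuclideanSpace.single i 1)
        (EuclideanSpace.single k 1) := by
    conv_lhs => rw [hw]
    simp [map_sum]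
  simp only [hk, ← h3]
  exact h1.trans (eq_sub_of_add_eq h2.symm)

/-- Every tangent vector of `TM` is a combination of coordinate vectors: the chart induced by `e` is
a smooth local inverse of `tangentParam e`. -/
theorem exists_tangentParam_eq_and_surjective_mfderiv (p : TangentBundle (𝓡 m) M) :
    ∃ e ∈ IsManifold.maximalAtlas (𝓡 m) ∞ M, ∃ z : (𝔼 m) × (𝔼 m), z.1 ∈ e.target ∧
      tangentParam e z = p ∧ Function.Surjective
        (mfderiv 𝓘(ℝ, (𝔼 m) × (𝔼 m)) (𝓡 m).tangent (tangentParam e) z) := by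
  let e := chartAt (𝔼 m) p.1
  have he : e ∈ IsManifold.maximalAtlas (𝓡 m) ∞ M := IsManifold.chart_mem_maximalAtlas p.1
  have hp : p.1 ∈ e.source := mem_chart_source _ _
  -- The chart of `TM` induced by `e`.
  let ρ : TangentBundle (𝓡 m) M → (𝔼 m) × (𝔼 m) :=
    fun q ↦ (e q.1, mfderiv (𝓡 m) (𝓡 m) e q.1 q.2)
  have hρ : MDifferentiableAt (𝓡 m).tangent 𝓘(ℝ, (𝔼 m) × (𝔼 m)) ρ p := by
    have h1 := (contMDiffOn_of_mem_maximalAtlas he).contMDiffOn_tangentMapWithin (m := ∞)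
      (by simp) e.open_source.uniqueMDiffOn
    have hopen : IsOpen (Bundle.TotalSpace.proj ⁻¹' e.source : Set (TangentBundle (𝓡 m) M)) :=
      e.open_source.preimage (FiberBundle.continuous_proj _ _)
    have h2 := h1.contMDiffAt (hopen.mem_nhds hp)
    have h3 := (contMDiff_snd_tangentBundle_modelSpace (𝔼 m) (𝓡 m) (n := ∞)).contMDiffAt.comp p h2
    have h4 := (contMDiffAt_of_mem_maximalAtlas he hp).comp p
      ((smoothProj (𝓡 m) M).contMDiff.contMDiffAt (x := p))
    refine ((h4.prodMk_space h3).congr_of_eventuallyEq ?_).mdifferentiableAt (by simp)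
    filter_upwards [hopen.mem_nhds hp] with q hq
    exact congrArg (fun L : (𝔼 m) →L[ℝ] (𝔼 m) ↦ (e q.1, L q.2))
      (mfderivWithin_of_isOpen (I := 𝓡 m) (I' := 𝓡 m) (f := e) e.open_source hq).symm
  have hinv : ∀ q : TangentBundle (𝓡 m) M, q.1 ∈ e.source → tangentParam e (ρ q) = q := by
    intro q hq
    have hd := (contMDiffAt_of_mem_maximalAtlas he hq).mdifferentiableAt (by simp)
    have hd' := (contMDiffAt_symm_of_mem_maximalAtlas he (e.map_source hq)).mdifferentiableAt
      (by simp)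
    have h1 := hd'.hasMFDerivAt.comp q.1 hd.hasMFDerivAt
    have h2 : HasMFDerivAt (𝓡 m) (𝓡 m) (e.symm ∘ e) q.1
        (ContinuousLinearMap.id ℝ (TangentSpace (𝓡 m) q.1)) := by
      refine (hasMFDerivAt_id q.1).congr_of_eventuallyEq ?_
      filter_upwards [e.open_source.mem_nhds hq] with x hx
      exact e.left_inv hx
    have h3 := congrArg (fun L : (𝔼 m) →L[ℝ] (𝔼 m) ↦ L q.2) (hasMFDerivAt_unique h1 h2)
    exact Bundle.TotalSpace.ext (e.left_inv hq) (heq_of_eq h3)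
  refine ⟨e, he, ρ p, e.map_source hp, hinv p hp, fun Y ↦ ?_⟩
  have h1 := ((contMDiffAt_tangentParam he (z := ρ p) (e.map_source hp)).mdifferentiableAt
    (by simp)).hasMFDerivAt.comp p hρ.hasMFDerivAt
  have h2 : HasMFDerivAt (𝓡 m).tangent (𝓡 m).tangent (tangentParam e ∘ ρ) p
      (ContinuousLinearMap.id ℝ (TangentSpace (𝓡 m).tangent p)) := by
    refine (hasMFDerivAt_id p).congr_of_eventuallyEq ?_
    have hopen : IsOpen (Bundle.TotalSpace.proj ⁻¹' e.source : Set (TangentBundle (𝓡 m) M)) :=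
      e.open_source.preimage (FiberBundle.continuous_proj _ _)
    filter_upwards [hopen.mem_nhds hp] with q hq
    exact hinv q hq
  exact ⟨_, congrArg (fun L : (𝔼 m) × (𝔼 m) →L[ℝ] (𝔼 m) × (𝔼 m) ↦ L Y) (hasMFDerivAt_unique h1 h2)⟩

/-- A closed 1-form on `TM` which vanishes on vertical vectors and along the zero section is zero:
in coordinates both `a_i` and `h_i` vanish. -/
theorem IsAbove.eq_zero {α : OneForm (𝓡 m).tangent (TangentBundle (𝓡 m) M)}
    (h0 : IsAbove α (0 : OneForm (𝓡 m) M))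
    (hα : α ∈ closedOneForms (𝓡 m).tangent (TangentBundle (𝓡 m) M))
    (hs : OneForm.pullback (smoothZeroSection (𝓡 m) M) α = 0) : α = 0 := by
  ext p Y
  obtain ⟨e, he, z, hz, rfl, hsurj⟩ := exists_tangentParam_eq_and_surjective_mfderiv p
  obtain ⟨⟨X, W⟩, rfl⟩ := hsurj Y
  have hzero : (0 : OneForm (𝓡 m) M).along e.symm = 0 := by
    funext y
    ext V
    rfl
  have hW := h0.along_tangentParam_vertical he hz W
  have hX := h0.along_tangentParam_horizontal hα he hz z.2 X
  rw [← α.pullback_smoothZeroSection_along he hz, hs, hzero] at hX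
  rw [hzero] at hW
  have hsum : α.along (tangentParam e) z (X, W) =
      α.along (tangentParam e) z (X, 0) + α.along (tangentParam e) z (0, W) := by
    rw [← map_add]
    simp
  refine hsum.trans ?_
  rw [hW, hX]
  simp

/-! ### The map to closed forms on the base -/

variable (m M) in
/-- The map `α ↦ s^* α` from closed 1-forms on `TM` of type `α_μ` to closed 1-forms on `M`, where
`s` is the zero section. -/
noncomputable def zeroSectionRestriction :
    closedAbove (𝓡 m) M →ₗ[ℝ] closedOneForms (𝓡 m) M :=
  (OneForm.pullback (smoothZeroSection (𝓡 m) M)).restrict fun _ hα ↦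
    OneForm.pullback_mem_closedOneForms _ hα.1

theorem zeroSectionRestriction_surjective :
    Function.Surjective (zeroSectionRestriction m M) := fun γ ↦
  ⟨⟨OneForm.pullback (smoothProj (𝓡 m) M) γ, OneForm.pullback_mem_closedOneForms _ γ.2, 0,
    isAbove_pullback_smoothProj _⟩,
    Subtype.ext (pullback_smoothZeroSection_pullback_smoothProj _)⟩

theorem coe_zeroSectionRestriction (α : closedAbove (𝓡 m) M) :
    (zeroSectionRestriction m M α : OneForm (𝓡 m) M) =
      OneForm.pullback (smoothZeroSection (𝓡 m) M) α := rfl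

/-- If `s^* α = dc` and `α` is a closed `α_μ`, then `α = df` for the fibre-affine function
`f = μ + c`; conversely `s^* df_ν = dc`. -/
theorem zeroSectionRestriction_mem_exactOneForms_iff (α : closedAbove (𝓡 m) M) :
    (zeroSectionRestriction m M α : OneForm (𝓡 m) M) ∈ exactOneForms (𝓡 m) M ↔
      (α : OneForm (𝓡 m).tangent (TangentBundle (𝓡 m) M)) ∈ affineExact (𝓡 m) M := by
  rw [coe_zeroSectionRestriction]
  constructor
  · rintro ⟨c, hc⟩
    obtain ⟨μ, hμ⟩ := α.2.2
    let δ := differential (𝓡 m).tangent (TangentBundle (𝓡 m) M) (affineFunction (𝓡 m) M (μ, c))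
    have habove : IsAbove (α.1 - δ) (0 : OneForm (𝓡 m) M) := by
      rw [← sub_self μ]
      exact hμ.sub (isAbove_differential_affineFunction (μ, c))
    have hclosed : α.1 - δ ∈ closedOneForms (𝓡 m).tangent (TangentBundle (𝓡 m) M) :=
      Submodule.sub_mem _ α.2.1 (differential_mem_closedOneForms _)
    have hzero : OneForm.pullback (smoothZeroSection (𝓡 m) M) (α.1 - δ) = 0 := by
      rw [map_sub, ← hc, sub_eq_zero]
      exact (pullback_smoothZeroSection_differential_affineFunction (μ, c)).symm
    exact ⟨(μ, c), (sub_eq_zero.1 (habove.eq_zero hclosed hzero)).symm⟩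
  · rintro ⟨νc, hνc⟩
    refine ⟨νc.2, ?_⟩
    rw [← pullback_smoothZeroSection_differential_affineFunction νc]
    exact congrArg (OneForm.pullback (smoothZeroSection (𝓡 m) M)) hνc

end Coordinates

theorem exists_linearEquiv_quotient {R A B : Type*} [Ring R] [AddCommGroup A] [Module R A]
    [AddCommGroup B] [Module R B] {f : A →ₗ[R] B} (hf : Function.Surjective f)
    {P : Submodule R A} {Q : Submodule R B} (hPQ : P = Q.comap f) :
    ∃ Φ : (A ⧸ P) ≃ₗ[R] B ⧸ Q,
      ∀ a, Φ (Submodule.Quotient.mk a) = Submodule.Quotient.mk (f a) := by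
  have hker : P = LinearMap.ker (Q.mkQ ∘ₗ f) := by rw [LinearMap.ker_comp, Q.ker_mkQ, hPQ]
  have hsurj : Function.Surjective (Q.mkQ ∘ₗ f) := Q.mkQ_surjective.comp hf
  exact ⟨(Submodule.quotEquivOfEq _ _ hker).trans ((Q.mkQ ∘ₗ f).quotKerEquivOfSurjective hsurj),
    fun _ ↦ rfl⟩

theorem mainTheorem2 (m : ℕ) (M : Type*) [TopologicalSpace M]
    [ChartedSpace (EuclideanSpace ℝ (Fin m)) M] [IsManifold (𝓡 m) ∞ M] :
    affineExact (𝓡 m) M ≤ closedAbove (𝓡 m) M ∧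
    ∃ Θ : closedAbove (𝓡 m) M →ₗ[ℝ] closedOneForms (𝓡 m) M,
      (∀ α : closedAbove (𝓡 m) M, IsTheta (α : OneForm (𝓡 m).tangent (TangentBundle (𝓡 m) M))
        (Θ α : OneForm (𝓡 m) M)) ∧
      ∃ Φ : (closedAbove (𝓡 m) M ⧸ (affineExact (𝓡 m) M).submoduleOf (closedAbove (𝓡 m) M))
          ≃ₗ[ℝ] DeRhamH1 (𝓡 m) M,
        ∀ α : closedAbove (𝓡 m) M,
          Φ (Submodule.Quotient.mk α) = Submodule.Quotient.mk (Θ α) := by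
  refine ⟨affineExact_le_closedAbove, zeroSectionRestriction m M, fun α ↦ ?_, ?_⟩
  · obtain ⟨μ, hμ⟩ := α.2.2
    rw [coe_zeroSectionRestriction]
    exact hμ.isTheta_pullback_smoothZeroSection α.2.1
  · refine exists_linearEquiv_quotient (f := zeroSectionRestriction m M)
      zeroSectionRestriction_surjective ?_
    ext α
    exact (zeroSectionRestriction_mem_exactOneForms_iff α).symm
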